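/- Throughout, a subdistribution over a set $S$ is a function $\Delta:S\to[0,1]$ with $\sum_{s}\Delta(s)\le 1$; it is a (full) distribution if the sum is $1$; its support is $\{s\mid\Delta(s)>0\}$. For $f:R\to S$ and a subdistribution $\Lambda$ over $R$, the image $f(\Lambda)$ is given by $f(\Lambda)(s)=\sum_{f(r)=s}\Lambda(r)$; for $g:R\to[0,1]^\Omega$, the expected value is $\mathrm{Exp}_\Lambda(g)=\sum_{r}\Lambda(r)\cdot g(r)\in[0,1]^\Omega$. A pLTS $\langle S,\Omega,\to\rangle$ consists of a set $S$ of states, a set $\Omega$ of visible (success) actions and a set of transitions $s\xrightarrow{\alpha}\Delta$ with $s\in S$, $\alpha\in\Omega\cup\{\tau\}$ (where $\tau\notin\Omega$ is the internal action) and $\Delta$ a full distribution over $S$. Write $s\xrightarrow{\alpha}$ if $s\xrightarrow{\alpha}\Delta$ for some $\Delta$. The pLTS is deterministic if for every $s,\alpha$ there is at most one $\Delta$ with $s\xrightarrow{\alpha}\Delta$; it is $\omega$-respecting if $s\xrightarrow{\omega}$ for some $\omega\in\Omega$ implies that $s$ has no $\tau$-transition. The relation $\xrightarrow{\tau}$ is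 lifted to subdistributions as the smallest relation such that (a) if $s\xrightarrow{\tau}\Delta$, then the point distribution at $s$ is related to $\Delta$, and (b) if $\Gamma_i\xrightarrow{\tau}\Delta_i$ for all $i\in I$ and $p_i\in[0,1]$ with $\sum_{i\in I}p_i\le1$, then $\sum_i p_i\Gamma_i\xrightarrow{\tau}\sum_i p_i\Delta_i$. A subdistribution $\Delta'$ is a weak derivative of $\Delta$ if there are subdistributions $\Delta_k^{\to},\Delta_k^{\times}$ ($k\ge0$) with $\Delta=\Delta_0^{\to}+\Delta_0^{\times}$, $\Delta_k^{\to}\xrightarrow{\tau}\Delta_{k+1}^{\to}+\Delta_{k+1}^{\times}$ for all $k\ge0$, and $\Delta'=\sum_{k\ge0}\Delta_k^{\times}$. It is an extreme derivative of $\Delta$ if moreover it is stable, i.e. no state in its support has a $\tau$-transition. The outcome of a stable subdistribution $\Delta'$ is the tuple $\$\Delta'\in[0,1]^\Omega$ with $\$\Delta'(\omega)=\sum\{\Delta'(s)\mid s\xrightarrow{\omega}\}$. A resolution of a subdistribution $\Delta$ over $S$ is a triple $\langle R,\Lambda,\to_R\rangle$ such that $\langle R,\Omega,\to_R\rangle$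 is a deterministic pLTS, $\Lambda$ is a subdistribution over $R$, and there is a function $f:R\to S$ with (i) $f(\Lambda)=\Delta$; (ii) if $r\xrightarrow{\alpha}_R\Lambda'$ then $f(r)\xrightarrow{\alpha}f(\Lambda')$; (iii) if $f(r)\xrightarrow{\alpha}$ then $r\xrightarrow{\alpha}_R$, for all $r\in R$ and $\alpha\in\Omega\cup\{\tau\}$. For a deterministic pLTS $\langle R,\Omega,\to_R\rangle$, let $\mathbb V:R\to[0,1]^\Omega$ be the least fixed point, in the pointwise order, of the monotone map sending $g$ to the function whose value at $r,\omega$ is $1$ if $r\xrightarrow{\omega}_R$; $0$ if $r$ has neither an $\omega$- nor a $\tau$-transition; and $\mathrm{Exp}_{\Theta}(g)(\omega)$ if $r$ has no $\omega$-transition and $r\xrightarrow{\tau}_R\Theta$. **Corollary.** Let $\langle S,\Omega,\to\rangle$ be an $\omega$-respecting pLTS and $\Delta$ a subdistribution over $S$. (i) For every extreme derivative $\Delta'$ of $\Delta$ there is a resolution $\langle R,\Lambda,\to_R\rangle$ of $\Delta$ with $\mathrm{Exp}_\Lambda(\mathbb V_{\langle R,\Omega,\to_R\rangle})=\$\Delta'$.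 (ii) For every resolution $\langle R,\Lambda,\to_R\rangle$ of $\Delta$ there is an extreme derivative $\Delta'$ of $\Delta$ with $\mathrm{Exp}_\Lambda(\mathbb V_{\langle R,\Omega,\to_R\rangle})=\$\Delta'$. -/

import Mathlib

open scoped ENNReal

universe u v w

/-- The unit interval `[0,1]`, as the set of extended nonnegative reals at most `1`
(a complete lattice under the usual order). -/
abbrev Unit01 : Type := Set.Iic (1 : ℝ≥0∞)

/-- A (discrete) probability subdistribution over `S`: total mass at most one. -/
@[ext]
structure SubDist (S : Type u) where
  prob : S → ℝ≥0∞
  mass_le : ∑' s, prob s ≤ 1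

namespace SubDist

/-- A full distribution (Mathlib's `PMF`), seen as a subdistribution. -/
noncomputable def ofPMF {S : Type u} (D : PMF S) : SubDist S where
  prob := fun s => D s
  mass_le := D.tsum_coe.le

/-- The point distribution at `s`. -/
noncomputable def point {S : Type u} (s : S) : SubDist S := ofPMF (PMF.pure s)

/-- The image of a subdistribution under `f`: `(image f Δ) t = ∑_{f s = t} Δ s`. -/
noncomputable def image {S : Type u} {T : Type v} (f : S → T) (Δ : SubDist S) :
    SubDist T where
  prob := fun t => ∑' s : {s // f s = t}, Δ.prob s
  mass_le := by
    rw [← ENNReal.tsum_sigma' (β := fun t => {s // f s = t}) (fun x => Δ.prob x.2),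
      ← (Equiv.sigmaFiberEquiv f).symm.tsum_eq]
    exact Δ.mass_le

/-- The weighted sum `∑ i, p i · Γ i` of subdistributions, for weights with `∑ i, p i ≤ 1`. -/
noncomputable def weightedSum {S : Type u} {ι : Type w} (p : ι → ℝ≥0∞) (hp : ∑' i, p i ≤ 1)
    (Γ : ι → SubDist S) : SubDist S where
  prob := fun s => ∑' i, p i * (Γ i).prob s
  mass_le := by
    rw [ENNReal.tsum_comm]
    refine le_trans (ENNReal.tsum_le_tsum fun i => ?_) hp
    rw [ENNReal.tsum_mul_left]
    exact mul_le_of_le_one_right' (Γ i).mass_le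

/-- The expected value over `Δ` of a function with values in `[0,1]^Ω`, computed
componentwise: `(expect Δ g) ω = ∑_s Δ s · g s ω`. -/
noncomputable def expect {S : Type u} {Ω : Type v} (Δ : SubDist S) (g : S → Ω → Unit01) :
    Ω → Unit01 := fun ω =>
  ⟨∑' s, Δ.prob s * (g s ω : ℝ≥0∞),
    le_trans (ENNReal.tsum_le_tsum fun s => mul_le_of_le_one_right' (g s ω).2) Δ.mass_le⟩

end SubDist

/-- The lifting of a relation between states and subdistributions to a relation between
subdistributions: the smallest one that contains `point s ↦ Δ` for all related `s, Δ` and is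
closed under weighted sums with total weight at most one. Since at most countably many
weights are nonzero, index types in the lowest universe are enough. -/
inductive Lifted {S : Type u} (Rel : S → SubDist S → Prop) :
    SubDist S → SubDist S → Prop
  | point {s : S} {Δ : SubDist S} (h : Rel s Δ) : Lifted Rel (SubDist.point s) Δ
  | linear {ι : Type} (p : ι → ℝ≥0∞) (hp : ∑' i, p i ≤ 1) (Γ Δ : ι → SubDist S)
      (h : ∀ i, Lifted Rel (Γ i) (Δ i)) :
      Lifted Rel (SubDist.weightedSum p hp Γ) (SubDist.weightedSum p hp Δ)

/-- A probabilistic labelled transition system with state set `S` and set of visible actions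
`Act`. A label is an element of `Option Act`: `none` is the internal action `τ`, and `some a`
is the visible action `a`. Transitions lead to full distributions. -/
structure PLTS (S : Type u) (Act : Type v) where
  Trans : S → Option Act → PMF S → Prop

namespace PLTS

variable {S : Type u} {Ω : Type v} {R : Type w}

/-- The state `s` has a transition labelled `α`. -/
def Enabled (T : PLTS S Ω) (s : S) (α : Option Ω) : Prop := ∃ D, T.Trans s α D

/-- At most one transition for each state and label. -/
def Deterministic (T : PLTS S Ω) : Prop :=
  ∀ s α D₁ D₂, T.Trans s α D₁ → T.Trans s α D₂ → D₁ = D₂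

/-- States that enable some visible (success) action have no `τ`-transition. -/
def OmegaRespecting (T : PLTS S Ω) : Prop :=
  ∀ s (ω : Ω), T.Enabled s (some ω) → ¬ T.Enabled s none

/-- The `τ`-step relation from states to subdistributions. -/
def TauStep (T : PLTS S Ω) (s : S) (Δ : SubDist S) : Prop :=
  ∃ D, T.Trans s none D ∧ Δ = SubDist.ofPMF D

/-- `Δ'` is a weak derivative of `Δ`: there are subdistributions `total k = go k + rest k`
with `total 0 = Δ`, a lifted `τ`-step from `go k` to `total (k + 1)` for every `k`, and
`Δ' = ∑ k, rest k`. -/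
def WeakDerivative (T : PLTS S Ω) (Δ Δ' : SubDist S) : Prop :=
  ∃ total go rest : ℕ → SubDist S,
    total 0 = Δ ∧
    (∀ k s, (total k).prob s = (go k).prob s + (rest k).prob s) ∧
    (∀ k, Lifted T.TauStep (go k) (total (k + 1))) ∧
    ∀ s, Δ'.prob s = ∑' k, (rest k).prob s

/-- No state in the support has a `τ`-transition. -/
def Stable (T : PLTS S Ω) (Δ : SubDist S) : Prop :=
  ∀ s, 0 < Δ.prob s → ¬ T.Enabled s none

/-- `Δ'` is an extreme derivative of `Δ`: a weak derivative that is stable. -/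
def ExtremeDerivative (T : PLTS S Ω) (Δ Δ' : SubDist S) : Prop :=
  T.WeakDerivative Δ Δ' ∧ T.Stable Δ'

/-- The outcome of a (stable) subdistribution: its `ω`-component is the total probability of
the states that enable `ω`. -/
noncomputable def outcome (T : PLTS S Ω) (Δ : SubDist S) : Ω → Unit01 := fun ω =>
  ⟨∑' s : {s // T.Enabled s (some ω)}, Δ.prob s,
    le_trans (ENNReal.tsum_comp_le_tsum_of_injective Subtype.val_injective Δ.prob) Δ.mass_le⟩

/-- `f : R → S` is a resolving function showing that the pLTS `TR` on `R` with `Λ` resolves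
the subdistribution `Δ` of the pLTS `T` on `S`. -/
structure IsResolvingFunction (T : PLTS S Ω) (Δ : SubDist S) (TR : PLTS R Ω) (Λ : SubDist R)
    (f : R → S) : Prop where
  image_eq : Λ.image f = Δ
  trans_map : ∀ r α Λ', TR.Trans r α Λ' → T.Trans (f r) α (Λ'.map f)
  enabled : ∀ r α, T.Enabled (f r) α → TR.Enabled r α

/-- `⟨R, Λ, TR⟩` is a resolution of the subdistribution `Δ` in the pLTS `T`. -/
def IsResolution (T : PLTS S Ω) (Δ : SubDist S) (TR : PLTS R Ω) (Λ : SubDist R) : Prop :=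
  TR.Deterministic ∧ ∃ f : R → S, T.IsResolvingFunction Δ TR Λ f

open Classical in
/-- The evaluation functional on `R → [0,1]^Ω` of a deterministic pLTS: at `r` and `ω` it is
`1` if `r` enables `ω`; otherwise it is the expected value of `g` over the target of the
`τ`-transition of `r` (unique by determinism), and `0` if there is none. -/
noncomputable def evalFun (T : PLTS R Ω) (g : R → Ω → Unit01) (r : R) (ω : Ω) : Unit01 :=
  if T.Enabled r (some ω) then ⊤
  else if h : T.Enabled r none then (SubDist.ofPMF h.choose).expect g ω
  else ⊥

theorem evalFun_mono (T : PLTS R Ω) : Monotone T.evalFun := by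
  intro g g' hg r ω
  unfold evalFun
  split_ifs
  · exact le_rfl
  · change (∑' s, _ * (g s ω : ℝ≥0∞)) ≤ ∑' s, _ * (g' s ω : ℝ≥0∞)
    exact ENNReal.tsum_le_tsum fun s => mul_le_mul' le_rfl (hg s ω)
  · exact le_rfl

/-- The value function `𝕍`: the least fixed point of the evaluation functional. -/
noncomputable def value (T : PLTS R Ω) : R → Ω → Unit01 :=
  OrderHom.lfp ⟨T.evalFun, T.evalFun_mono⟩

end PLTS

/-! Both directions compute the expected value step by step. By monotone convergence `𝕍` is the
supremum of the iterates of the evaluation functional on `⊥`, and each application splits off the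
success mass of the part stopping at step `k` (`expect_value_eq_tsum`). Summing over `k` gives an
outcome; since success states cannot move, no success mass is counted twice.

From a resolution, let every state that can move do so. The stopped mass, pushed forward along the
resolving function, is an extreme derivative.

Conversely, each lifted step is a random choice of transitions (`exists_kernel_of_lifted`). A
resolution must be deterministic, so the randomness goes into the state: a state records the time
and an already drawn transition, and the next draw happens on arrival. -/

theorem ENNReal.tsum_iSup_of_monotone {α : Type*} {f : ℕ → α → ℝ≥0∞} (hf : Monotone f) :
    ∑' a, ⨆ n, f n a = ⨆ n, ∑' a, f n a := by
  simp only [ENNReal.tsum_eq_iSup_sum]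
  rw [iSup_comm]
  refine iSup_congr fun s => ?_
  exact ENNReal.finsetSum_iSup_of_monotone fun a m n h => hf h a

namespace SubDist

theorem tsum_image_mul {S : Type u} {T : Type v} (f : S → T) (Δ : SubDist S) (g : T → ℝ≥0∞) :
    ∑' t, (Δ.image f).prob t * g t = ∑' s, Δ.prob s * g (f s) := by
  rw [← ENNReal.tsum_fiberwise (fun s => Δ.prob s * g (f s)) f]
  refine tsum_congr fun t => ?_
  rw [image, ← ENNReal.tsum_mul_right]
  exact tsum_congr fun s => by rw [show f s = t from s.2]

theorem image_prob {S : Type u} {T : Type v} (f : S → T) (Δ : SubDist S) (t : T) :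
    (Δ.image f).prob t = ∑' s, Δ.prob s * PMF.pure (f s) t := by
  rw [← tsum_image_mul f Δ fun t' => PMF.pure t' t, tsum_eq_single t]
  · simp
  · intro t' h
    simp [PMF.pure_apply, h.symm]

end SubDist

namespace PMF

theorem tsum_bind_mul {α : Type u} {β : Type v} (p : PMF α) (f : α → PMF β) (g : β → ℝ≥0∞) :
    ∑' b, p.bind f b * g b = ∑' a, p a * ∑' b, f a b * g b := by
  simp only [bind_apply, ← ENNReal.tsum_mul_right, ← ENNReal.tsum_mul_left]
  rw [ENNReal.tsum_comm]
  simp only [mul_assoc]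

theorem tsum_pure_mul {α : Type u} (a : α) (g : α → ℝ≥0∞) : ∑' b, pure a b * g b = g a := by
  rw [tsum_eq_single a]
  · simp
  · intro b h
    simp [pure_apply, h]

theorem tsum_map_mul {α : Type u} {β : Type v} (p : PMF α) (f : α → β) (g : β → ℝ≥0∞) :
    ∑' b, p.map f b * g b = ∑' a, p a * g (f a) := by
  rw [← bind_pure_comp, tsum_bind_mul]
  simp

end PMF

/-! ### Lifted steps as weighted and randomised choices -/

namespace Lifted

variable {S : Type u} {Rel : S → SubDist S → Prop}

/-- Closure of the lifting under weighted sums over arbitrary index types, where only the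
indices of nonzero weight matter. -/
theorem weightedSum {ι : Type w} (p : ι → ℝ≥0∞) (hp : ∑' i, p i ≤ 1) (Γ Δ : ι → SubDist S)
    (h : ∀ i, p i ≠ 0 → Lifted Rel (Γ i) (Δ i)) :
    Lifted Rel (SubDist.weightedSum p hp Γ) (SubDist.weightedSum p hp Δ) := by
  -- A finite total weight forces countable support, which can be reindexed by a type in the lowest
  -- universe.
  have : Countable (Function.support p) :=
    (Summable.countable_support_ennreal (ne_top_of_le_ne_top ENNReal.one_ne_top hp)).to_subtype
  let e := equivShrink.{0} (Function.support p)
  have key (g : ι → ℝ≥0∞) : ∑' j, p (e.symm j) * g (e.symm j) = ∑' i, p i * g i := by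
    rw [e.symm.tsum_eq (fun i : Function.support p => p i * g i)]
    exact tsum_subtype_eq_of_support_subset (f := fun i => p i * g i)
      fun i hi => left_ne_zero_of_mul hi
  have hp' : ∑' j, p (e.symm j) ≤ 1 := by
    have := key 1
    simp only [Pi.one_apply, mul_one] at this
    exact this.trans_le hp
  have eq (Γ : ι → SubDist S) : SubDist.weightedSum p hp Γ =
      SubDist.weightedSum (fun j => p (e.symm j)) hp' fun j => Γ (e.symm j) := by
    ext s
    exact (key fun i => (Γ i).prob s).symm
  rw [eq Γ, eq Δ]
  exact linear _ hp' _ _ fun j => h _ (e.symm j).2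

end Lifted

namespace PLTS

variable {S : Type u} {Ω : Type v} {R : Type w}

/-- Every lifted `τ`-step comes from a joint weight on the `τ`-transitions used. -/
theorem exists_weight_of_lifted (T : PLTS S Ω) {Γ Θ : SubDist S} (h : Lifted T.TauStep Γ Θ) :
    ∃ q : S → PMF S → ℝ≥0∞, (∀ s D, q s D ≠ 0 → T.Trans s none D) ∧
      (∀ s, ∑' D, q s D = Γ.prob s) ∧ ∀ t, Θ.prob t = ∑' s, ∑' D, q s D * D t := by
  classical
  induction h with
  | @point s Δ h =>
    obtain ⟨D, hD, rfl⟩ := h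
    refine ⟨fun s' D' => PMF.pure s s' * PMF.pure D D', fun s' D' hq => ?_, fun s' => ?_,
      fun t => ?_⟩
    · have h1 := left_ne_zero_of_mul hq
      have h2 := right_ne_zero_of_mul hq
      simp only [PMF.pure_apply, ne_eq, ite_eq_right_iff, one_ne_zero, imp_false,
        not_not] at h1 h2
      rwa [h1, h2]
    · rw [ENNReal.tsum_mul_left, PMF.tsum_coe, mul_one]
      rfl
    · simp only [mul_assoc, ENNReal.tsum_mul_left, PMF.tsum_pure_mul]
      rfl
  | linear p hp Γ Δ _ ih =>
    choose q hq1 hq2 hq3 using ih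
    refine ⟨fun s D => ∑' i, p i * q i s D, fun s D h => ?_, fun s => ?_, fun t => ?_⟩
    · rw [ne_eq, ENNReal.tsum_eq_zero, not_forall] at h
      obtain ⟨i, hi⟩ := h
      exact hq1 i s D (right_ne_zero_of_mul hi)
    · rw [ENNReal.tsum_comm]
      simp only [ENNReal.tsum_mul_left, hq2]
      rfl
    · simp only [SubDist.weightedSum, hq3, ← ENNReal.tsum_mul_left, ← ENNReal.tsum_mul_right]
      rw [ENNReal.tsum_comm]
      refine tsum_congr fun s => ?_
      rw [ENNReal.tsum_comm]
      simp only [mul_assoc]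

/-- Every lifted `τ`-step is given by a randomised choice of `τ`-transitions. -/
theorem exists_kernel_of_lifted (T : PLTS S Ω) {Γ Θ : SubDist S} (h : Lifted T.TauStep Γ Θ) :
    ∃ c : S → PMF (PMF S),
      (∀ s, Γ.prob s ≠ 0 → ∀ D, c s D ≠ 0 → T.Trans s none D) ∧
      ∀ t, Θ.prob t = ∑' s, Γ.prob s * ∑' D, c s D * D t := by
  obtain ⟨q, hq1, hq2, hq3⟩ := T.exists_weight_of_lifted h
  have top (s : S) : Γ.prob s ≠ ∞ :=
    ne_top_of_le_ne_top ENNReal.one_ne_top ((ENNReal.le_tsum s).trans Γ.mass_le)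
  have this (s : S) : ∃ c : PMF (PMF S), ∀ D, q s D = Γ.prob s * c D := by
    by_cases hs : Γ.prob s = 0
    -- Without mass at `s` all weights vanish, so any choice serves.
    · refine ⟨PMF.pure (PMF.pure s), fun D => ?_⟩
      have := hq2 s
      rw [hs, ENNReal.tsum_eq_zero] at this
      simp [this, hs]
    · refine ⟨PMF.normalize (q s) (by rwa [hq2]) (by rw [hq2]; exact top s), fun D => ?_⟩
      rw [PMF.normalize_apply, hq2, mul_left_comm, ENNReal.mul_inv_cancel hs (top s), mul_one]
  choose c hc using this
  refine ⟨c, fun s hs D hD => hq1 s D ?_, fun t => ?_⟩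
  · rw [hc]
    exact mul_ne_zero hs hD
  · rw [hq3]
    simp only [hc, mul_assoc, ENNReal.tsum_mul_left]

/-! ### The value function as a limit of iterates -/

section Value

variable (T : PLTS R Ω)

theorem evalFun_of_enabled (g : R → Ω → Unit01) {r : R} {ω : Ω} (h : T.Enabled r (some ω)) :
    (T.evalFun g r ω : ℝ≥0∞) = 1 := by
  rw [evalFun, if_pos h]
  rfl

theorem evalFun_of_not_enabled (g : R → Ω → Unit01) {r : R} {ω : Ω}
    (h : ¬ T.Enabled r (some ω)) (h' : ¬ T.Enabled r none) :
    (T.evalFun g r ω : ℝ≥0∞) = 0 := by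
  rw [evalFun, if_neg h, dif_neg h']
  rfl

theorem evalFun_of_trans (hT : T.Deterministic) (g : R → Ω → Unit01) {r : R} {ω : Ω}
    (h : ¬ T.Enabled r (some ω)) {D : PMF R} (hD : T.Trans r none D) :
    (T.evalFun g r ω : ℝ≥0∞) = ∑' r', D r' * (g r' ω : ℝ≥0∞) := by
  have hE : T.Enabled r none := ⟨D, hD⟩
  rw [evalFun, if_neg h, dif_pos hE, hT _ _ _ _ hE.choose_spec hD]
  rfl

theorem iterate_evalFun_mono : Monotone fun n => T.evalFun^[n] ⊥ :=
  Monotone.monotone_iterate_of_le_map T.evalFun_mono bot_le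

/-- The value function is the limit of the iterates of the evaluation functional. -/
theorem coe_value (r : R) (ω : Ω) :
    (T.value r ω : ℝ≥0∞) = ⨆ n, (T.evalFun^[n] ⊥ r ω : ℝ≥0∞) := by
  apply le_antisymm
  -- The supremum of the iterates is a pre-fixed point, hence lies above the least one.
  · let G : R → Ω → Unit01 := fun r ω =>
      ⟨⨆ n, (T.evalFun^[n] ⊥ r ω : ℝ≥0∞),
        Set.mem_Iic.2 (iSup_le fun n => (T.evalFun^[n] ⊥ r ω).2)⟩
    have hG : T.evalFun G ≤ G := by
      intro r ω
      change (T.evalFun G r ω : ℝ≥0∞) ≤ ⨆ n, (T.evalFun^[n] ⊥ r ω : ℝ≥0∞)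
      have hle (n : ℕ) : (T.evalFun (T.evalFun^[n] ⊥) r ω : ℝ≥0∞) ≤
          ⨆ n, (T.evalFun^[n] ⊥ r ω : ℝ≥0∞) := by
        rw [← Function.iterate_succ_apply' T.evalFun]
        exact le_iSup (fun n => (T.evalFun^[n] ⊥ r ω : ℝ≥0∞)) (n + 1)
      by_cases h : T.Enabled r (some ω)
      · exact ((evalFun_of_enabled T _ h).trans
          (evalFun_of_enabled T (T.evalFun^[0] ⊥) h).symm).trans_le (hle 0)
      by_cases h' : T.Enabled r none
      · unfold evalFun at hle ⊢
        simp only [if_neg h, dif_pos h', SubDist.expect, G] at hle ⊢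
        simp only [ENNReal.mul_iSup]
        rw [ENNReal.tsum_iSup_of_monotone]
        · exact iSup_le hle
        · intro m n hmn a
          exact mul_le_mul' le_rfl (Subtype.coe_le_coe.2 (T.iterate_evalFun_mono hmn a ω))
      · rw [evalFun_of_not_enabled T _ h h']
        exact zero_le
    exact OrderHom.lfp_le ⟨T.evalFun, T.evalFun_mono⟩ hG r ω
  · refine iSup_le fun n => ?_
    have : T.evalFun^[n] ⊥ ≤ T.value := by
      induction n with
      | zero => exact bot_le
      | succ n ih =>
        rw [Function.iterate_succ_apply']
        exact (T.evalFun_mono ih).trans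
          (OrderHom.map_lfp ⟨T.evalFun, T.evalFun_mono⟩).le
    exact this r ω

/-- If applying the evaluation functional splits off a constant and moves on to the next
expectation functional, then the expected value is the sum of these constants. -/
theorem expect_value_eq_tsum (Λ : SubDist R) (ω : Ω) (E : ℕ → (R → Ω → Unit01) → ℝ≥0∞)
    (a : ℕ → ℝ≥0∞) (h0 : ∀ g, E 0 g = Λ.expect g ω)
    (hE : ∀ k g, E k (T.evalFun g) = a k + E (k + 1) g) (hbot : ∀ k, E k ⊥ = 0) :
    (Λ.expect T.value ω : ℝ≥0∞) = ∑' k, a k := by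
  -- The start `k` must vary, because each evaluation shifts `E k` to `E (k + 1)`.
  have key (n : ℕ) : ∀ k, E k (T.evalFun^[n] ⊥) = ∑ i ∈ Finset.range n, a (k + i) := by
    induction n with
    | zero => simpa using hbot
    | succ n ih =>
      intro k
      rw [Function.iterate_succ_apply', hE, ih, Finset.sum_range_succ', add_comm, add_zero]
      simp only [add_assoc, add_comm 1]
  rw [ENNReal.tsum_eq_iSup_nat]
  simp only [SubDist.expect, coe_value, ENNReal.mul_iSup]
  rw [ENNReal.tsum_iSup_of_monotone]
  · refine iSup_congr fun n => ?_
    have := key n 0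
    simp only [zero_add] at this
    rw [← this, h0]
    rfl
  · intro m n hmn r
    exact mul_le_mul' le_rfl (Subtype.coe_le_coe.2 (T.iterate_evalFun_mono hmn r ω))

end Value
end PLTS

/-! ### From resolutions to extreme derivatives -/

namespace PLTS

variable {S : Type u} {Ω : Type v} {R : Type w}

theorem coe_outcome (T : PLTS S Ω) (Δ : SubDist S) (ω : Ω) :
    (T.outcome Δ ω : ℝ≥0∞) = ∑' s, {s | T.Enabled s (some ω)}.indicator Δ.prob s :=
  tsum_subtype {s | T.Enabled s (some ω)} Δ.prob

section Evolution

variable (T : PLTS R Ω)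

/-- The part of a subdistribution on states with a `τ`-transition. -/
noncomputable def active (μ : SubDist R) : SubDist R where
  prob := {r | T.Enabled r none}.indicator μ.prob
  mass_le := (ENNReal.tsum_le_tsum fun r => Set.indicator_le_self _ _ r).trans μ.mass_le

/-- The part of a subdistribution on states without `τ`-transition. -/
noncomputable def inactive (μ : SubDist R) : SubDist R where
  prob := {r | T.Enabled r none}ᶜ.indicator μ.prob
  mass_le := (ENNReal.tsum_le_tsum fun r => Set.indicator_le_self _ _ r).trans μ.mass_le

theorem active_add_inactive (μ : SubDist R) (r : R) :
    (T.active μ).prob r + (T.inactive μ).prob r = μ.prob r :=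
  Set.indicator_self_add_compl_apply _ _ _

theorem enabled_of_active_ne_zero {μ : SubDist R} {r : R} (h : (T.active μ).prob r ≠ 0) :
    T.Enabled r none :=
  Set.mem_of_indicator_ne_zero (s := {r | T.Enabled r none}) h

theorem not_enabled_of_inactive_ne_zero {μ : SubDist R} {r : R}
    (h : (T.inactive μ).prob r ≠ 0) : ¬ T.Enabled r none :=
  Set.mem_of_indicator_ne_zero h

open Classical in
/-- A choice of a `τ`-successor of each state that has one. -/
noncomputable def succ (r : R) : PMF R :=
  if h : T.Enabled r none then h.choose else PMF.pure r

theorem trans_succ {r : R} (h : T.Enabled r none) : T.Trans r none (T.succ r) := by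
  rw [succ, dif_pos h]
  exact h.choose_spec

/-- One `τ`-step of the active part. -/
noncomputable def evolve (μ : SubDist R) : SubDist R :=
  SubDist.weightedSum (T.active μ).prob (T.active μ).mass_le fun r => SubDist.ofPMF (T.succ r)

theorem tsum_evolve_mul (μ : SubDist R) (g : R → ℝ≥0∞) :
    ∑' r, (T.evolve μ).prob r * g r =
      ∑' r, (T.active μ).prob r * ∑' r', T.succ r r' * g r' := by
  simp only [evolve, SubDist.weightedSum, SubDist.ofPMF, ← ENNReal.tsum_mul_right,
    ← ENNReal.tsum_mul_left]
  rw [ENNReal.tsum_comm]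
  simp only [mul_assoc]

theorem tsum_evolve (μ : SubDist R) :
    ∑' r, (T.evolve μ).prob r = ∑' r, (T.active μ).prob r := by
  simpa [PMF.tsum_coe] using T.tsum_evolve_mul μ fun _ => 1

/-- The distribution after `k` steps from `Λ`. -/
noncomputable def run (Λ : SubDist R) (k : ℕ) : SubDist R := T.evolve^[k] Λ

theorem run_succ (Λ : SubDist R) (k : ℕ) : T.run Λ (k + 1) = T.evolve (T.run Λ k) :=
  Function.iterate_succ_apply' _ _ _

/-- Mass conservation: a step keeps the active mass. It bounds the total stopped mass by that of
`Λ`. -/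
theorem sum_tsum_inactive_run (Λ : SubDist R) (n : ℕ) :
    ∑ k ∈ Finset.range n, ∑' r, (T.inactive (T.run Λ k)).prob r + ∑' r, (T.run Λ n).prob r =
      ∑' r, Λ.prob r := by
  induction n with
  | zero => simp [run]
  | succ n ih =>
    rw [← ih, Finset.sum_range_succ, run_succ, tsum_evolve, add_assoc, ← ENNReal.tsum_add]
    simp only [add_comm ((T.inactive _).prob _), active_add_inactive]

/-- The mass that eventually stops. -/
noncomputable def limit (Λ : SubDist R) : SubDist R where
  prob := fun r => ∑' k, (T.inactive (T.run Λ k)).prob r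
  mass_le := by
    rw [ENNReal.tsum_comm, ENNReal.tsum_eq_iSup_nat]
    exact iSup_le fun n => (le_self_add.trans (T.sum_tsum_inactive_run Λ n).le).trans Λ.mass_le

/-- In a deterministic pLTS the expected value is the outcome of the mass that eventually
stops. -/
theorem expect_value_eq_outcome_limit (hdet : T.Deterministic) (hT : T.OmegaRespecting)
    (Λ : SubDist R) (ω : Ω) :
    (Λ.expect T.value ω : ℝ≥0∞) = T.outcome (T.limit Λ) ω := by
  rw [T.expect_value_eq_tsum Λ ω (fun k g => ∑' r, (T.run Λ k).prob r * (g r ω : ℝ≥0∞))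
    (fun k => T.outcome (T.inactive (T.run Λ k)) ω) (fun g => rfl)]
  · simp only [outcome, limit]
    rw [ENNReal.tsum_comm]
  · intro k g
    rw [run_succ, tsum_evolve_mul, coe_outcome, ← ENNReal.tsum_add]
    refine tsum_congr fun r => ?_
    by_cases hω : T.Enabled r (some ω)
    · have hτ := hT r ω hω
      rw [evalFun_of_enabled T g hω]
      simp [active, inactive, hω, hτ]
    · by_cases hτ : T.Enabled r none
      · rw [evalFun_of_trans T hdet g hω (T.trans_succ hτ)]
        simp [active, hω, hτ]
      · rw [evalFun_of_not_enabled T g hω hτ]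
        simp [active, hω, hτ]
  · intro k
    simp

end Evolution

namespace IsResolvingFunction

variable {T : PLTS S Ω} {Δ : SubDist S} {TR : PLTS R Ω} {Λ : SubDist R} {f : R → S}

theorem enabled_iff (h : T.IsResolvingFunction Δ TR Λ f) (r : R) (α : Option Ω) :
    TR.Enabled r α ↔ T.Enabled (f r) α :=
  ⟨fun ⟨D, hD⟩ => ⟨_, h.trans_map r α D hD⟩, h.enabled r α⟩

theorem omegaRespecting (h : T.IsResolvingFunction Δ TR Λ f) (hT : T.OmegaRespecting) :
    TR.OmegaRespecting := by
  intro r ω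
  rw [h.enabled_iff, h.enabled_iff]
  exact hT _ _

/-- States over the same `f r` may move differently; the lifting permits such mixtures, so the sum
is indexed by `r`. -/
theorem lifted_image_active (h : T.IsResolvingFunction Δ TR Λ f) (μ : SubDist R) :
    Lifted T.TauStep ((TR.active μ).image f) ((TR.evolve μ).image f) := by
  have h1 : (TR.active μ).image f = SubDist.weightedSum (TR.active μ).prob
      (TR.active μ).mass_le fun r => SubDist.point (f r) := by
    ext s
    exact SubDist.image_prob _ _ _
  have h2 : (TR.evolve μ).image f = SubDist.weightedSum (TR.active μ).prob
      (TR.active μ).mass_le fun r => SubDist.ofPMF ((TR.succ r).map f) := by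
    ext s
    rw [SubDist.image_prob, tsum_evolve_mul]
    rfl
  rw [h1, h2]
  refine Lifted.weightedSum _ _ _ _ fun r hr => Lifted.point ?_
  exact ⟨_, h.trans_map _ _ _ (TR.trans_succ (TR.enabled_of_active_ne_zero hr)), rfl⟩

theorem extremeDerivative_image_limit (h : T.IsResolvingFunction Δ TR Λ f) :
    T.ExtremeDerivative Δ ((TR.limit Λ).image f) := by
  refine ⟨⟨fun k => (TR.run Λ k).image f, fun k => (TR.active (TR.run Λ k)).image f,
    fun k => (TR.inactive (TR.run Λ k)).image f, h.image_eq, fun k s => ?_, fun k => ?_,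
    fun s => ?_⟩, fun s hs hτ => ?_⟩
  · simp only [SubDist.image_prob, ← active_add_inactive TR (TR.run Λ k), add_mul,
      ENNReal.tsum_add]
  · beta_reduce
    rw [run_succ]
    exact h.lifted_image_active _
  · simp only [SubDist.image]
    rw [ENNReal.tsum_comm]
    rfl
  · obtain ⟨⟨r, rfl⟩, hr⟩ := not_forall.1 (mt ENNReal.tsum_eq_zero.2 hs.ne')
    obtain ⟨k, hk⟩ := not_forall.1 (mt ENNReal.tsum_eq_zero.2 hr)
    exact TR.not_enabled_of_inactive_ne_zero hk (h.enabled r none hτ)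

theorem outcome_image (h : T.IsResolvingFunction Δ TR Λ f) (μ : SubDist R) :
    T.outcome (μ.image f) = TR.outcome μ := by
  classical
  ext ω
  have := SubDist.tsum_image_mul f μ ({s | T.Enabled s (some ω)}.indicator 1)
  simp only [coe_outcome]
  simp only [h.enabled_iff]
  refine (tsum_congr fun s => ?_).trans (this.trans (tsum_congr fun r => ?_)) <;>
    simp [Set.indicator_apply]

end IsResolvingFunction

theorem exists_extremeDerivative (T : PLTS S Ω) (hT : T.OmegaRespecting) (Δ : SubDist S)
    (TR : PLTS R Ω) (Λ : SubDist R) (h : T.IsResolution Δ TR Λ) :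
    ∃ Δ' : SubDist S, T.ExtremeDerivative Δ Δ' ∧ Λ.expect TR.value = T.outcome Δ' := by
  obtain ⟨hdet, f, hf⟩ := h
  refine ⟨_, hf.extremeDerivative_image_limit, ?_⟩
  ext ω
  rw [TR.expect_value_eq_outcome_limit hdet (hf.omegaRespecting hT), hf.outcome_image]

end PLTS

/-! ### From extreme derivatives to resolutions -/

namespace PLTS

variable {S : Type u} {Ω : Type v}

open Classical in
/-- The target of an `α`-transition of `s`: the proposed one if it is available. -/
noncomputable def select (T : PLTS S Ω) (s : S) (α : Option Ω) (D : PMF S) : PMF S :=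
  if T.Trans s α D then D else if h : T.Enabled s α then h.choose else D

theorem select_of_trans (T : PLTS S Ω) {s : S} {α : Option Ω} {D : PMF S} (h : T.Trans s α D) :
    T.select s α D = D := if_pos h

theorem trans_select (T : PLTS S Ω) {s : S} {α : Option Ω} (D : PMF S) (h : T.Enabled s α) :
    T.Trans s α (T.select s α D) := by
  unfold select
  split_ifs with hD
  · exact hD
  · exact h.choose_spec

/-- Resample the scheduled transition at time `k` for each state in the target. -/
noncomputable def schedule (c : ℕ → S → PMF (PMF S)) (k : ℕ) (D : PMF S) :
    PMF (S × ℕ × PMF S) :=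
  D.bind fun t => (c k t).map fun D' => (t, k, D')

/-- The pLTS of states with a time and a scheduled transition, where `c k s` is the random
choice of the transition scheduled for the state `s` at time `k`. -/
def scheduled (T : PLTS S Ω) (c : ℕ → S → PMF (PMF S)) : PLTS (S × ℕ × PMF S) Ω where
  Trans r α Λ' := T.Enabled r.1 α ∧ Λ' = schedule c (r.2.1 + 1) (T.select r.1 α r.2.2)

/-- A subdistribution with transitions scheduled at time `0`. -/
noncomputable def scheduledInit (c : ℕ → S → PMF (PMF S)) (Δ : SubDist S) :
    SubDist (S × ℕ × PMF S) :=
  SubDist.weightedSum Δ.prob Δ.mass_le fun s => SubDist.ofPMF ((c 0 s).map fun D => (s, 0, D))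

theorem tsum_schedule_mul (c : ℕ → S → PMF (PMF S)) (k : ℕ) (D : PMF S)
    (g : S × ℕ × PMF S → ℝ≥0∞) :
    ∑' r, schedule c k D r * g r = ∑' t, D t * ∑' D', c k t D' * g (t, k, D') := by
  simp only [schedule, PMF.tsum_bind_mul, PMF.tsum_map_mul]

theorem map_fst_schedule (c : ℕ → S → PMF (PMF S)) (k : ℕ) (D : PMF S) :
    (schedule c k D).map Prod.fst = D := by
  have h (t : S) : ((c k t).map fun D' => (t, k, D')).map Prod.fst = PMF.pure t := by
    rw [PMF.map_comp]
    exact PMF.map_const _ _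
  simp only [schedule, PMF.map_bind, h, PMF.bind_pure]

theorem tsum_scheduledInit_mul (c : ℕ → S → PMF (PMF S)) (Δ : SubDist S)
    (g : S × ℕ × PMF S → ℝ≥0∞) :
    ∑' r, (scheduledInit c Δ).prob r * g r =
      ∑' s, Δ.prob s * ∑' D, c 0 s D * g (s, 0, D) := by
  simp only [← PMF.tsum_map_mul (c 0 _) (fun D => (_, 0, D)), scheduledInit,
    SubDist.weightedSum, SubDist.ofPMF, ← ENNReal.tsum_mul_right, ← ENNReal.tsum_mul_left]
  rw [ENNReal.tsum_comm]
  simp only [mul_assoc]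

theorem tsum_mul_of_kernel {Γ Θ : SubDist S} {c : S → PMF (PMF S)}
    (h : ∀ t, Θ.prob t = ∑' s, Γ.prob s * ∑' D, c s D * D t) (g : S → ℝ≥0∞) :
    ∑' t, Θ.prob t * g t = ∑' s, Γ.prob s * ∑' D, c s D * ∑' t, D t * g t := by
  simp only [h, ← ENNReal.tsum_mul_right, ← ENNReal.tsum_mul_left]
  rw [ENNReal.tsum_comm]
  refine tsum_congr fun s => ?_
  rw [ENNReal.tsum_comm]
  simp only [mul_assoc]

theorem enabled_scheduled_iff (T : PLTS S Ω) (c : ℕ → S → PMF (PMF S)) (r : S × ℕ × PMF S)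
    (α : Option Ω) : (T.scheduled c).Enabled r α ↔ T.Enabled r.1 α :=
  ⟨fun ⟨_, h⟩ => h.1, fun h => ⟨_, h, rfl⟩⟩

theorem deterministic_scheduled (T : PLTS S Ω) (c : ℕ → S → PMF (PMF S)) :
    (T.scheduled c).Deterministic := by
  rintro r α _ _ ⟨_, rfl⟩ ⟨_, rfl⟩
  rfl

/-- Projecting to the first component forgets the draws. The fallback in `select` secures the
transition conditions even where the recorded `D` is not a transition. -/
theorem isResolution_scheduled (T : PLTS S Ω) (c : ℕ → S → PMF (PMF S)) (Δ : SubDist S) :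
    T.IsResolution Δ (T.scheduled c) (scheduledInit c Δ) := by
  refine ⟨T.deterministic_scheduled c, Prod.fst, ?_, ?_, fun r α =>
    (T.enabled_scheduled_iff c r α).2⟩
  · ext s
    rw [SubDist.image_prob, tsum_scheduledInit_mul]
    simp only [ENNReal.tsum_mul_right, PMF.tsum_coe, one_mul]
    rw [tsum_eq_single s]
    · simp
    · intro t ht
      simp [PMF.pure_apply, ht.symm]
  · rintro r α _ ⟨h, rfl⟩
    rw [map_fst_schedule]
    exact T.trans_select _ h

theorem exists_resolution (T : PLTS S Ω) (hT : T.OmegaRespecting) (Δ Δ' : SubDist S)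
    (h : T.ExtremeDerivative Δ Δ') :
    ∃ (R : Type u) (TR : PLTS R Ω) (Λ : SubDist R),
      T.IsResolution Δ TR Λ ∧ Λ.expect TR.value = T.outcome Δ' := by
  obtain ⟨⟨total, go, rest, rfl, hadd, hstep, hsum⟩, hstable⟩ := h
  choose c hc htotal using fun k => T.exists_kernel_of_lifted (hstep k)
  refine ⟨_, T.scheduled c, scheduledInit c (total 0), T.isResolution_scheduled c _, ?_⟩
  -- By stability and `hgo` below, `total k` is all `go k` on states with a `τ`-transition and all
  -- `rest k` on the others.
  have hrest (k : ℕ) (s : S) (hτ : T.Enabled s none) : (rest k).prob s = 0 := by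
    by_contra hne
    refine hstable s ?_ hτ
    rw [hsum]
    exact (pos_iff_ne_zero.2 hne).trans_le (ENNReal.le_tsum k)
  have hgo (k : ℕ) (s : S) (hτ : ¬ T.Enabled s none) : (go k).prob s = 0 := by
    by_contra hne
    obtain ⟨D, hD⟩ := (c k s).support_nonempty
    exact hτ ⟨D, hc k s hne D hD⟩
  ext ω
  rw [expect_value_eq_tsum _ _ ω
    (fun k g => ∑' s, (total k).prob s * ∑' D, c k s D * (g (s, k, D) ω : ℝ≥0∞))
    (fun k => T.outcome (rest k) ω) (fun g => (tsum_scheduledInit_mul c _ fun r => (g r ω : ℝ≥0∞)).symm)]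
  · simp only [outcome, hsum]
    rw [ENNReal.tsum_comm]
  · intro k g
    rw [tsum_mul_of_kernel (htotal k), coe_outcome, ← ENNReal.tsum_add]
    refine tsum_congr fun s => ?_
    by_cases hω : T.Enabled s (some ω)
    · have hτ := hT s ω hω
      simp only [evalFun_of_enabled _ g ((T.enabled_scheduled_iff c (s, k, _) _).2 hω), mul_one,
        PMF.tsum_coe, hadd, hgo k s hτ]
      simp [hω]
    · have hω' (D : PMF S) := mt (T.enabled_scheduled_iff c (s, k, D) (some ω)).1 hω
      by_cases hτ : T.Enabled s none
      · rw [hadd, hrest k s hτ, add_zero,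
          Set.indicator_of_notMem (s := {s | T.Enabled s (some ω)}) hω, zero_add]
        -- Only where `go k` has mass is `c k s` known to draw genuine transitions, which `select`
        -- then leaves unchanged.
        by_cases hs : (go k).prob s = 0
        · rw [hs, zero_mul, zero_mul]
        congr 1
        refine tsum_congr fun D => ?_
        by_cases hD : c k s D = 0
        · rw [hD, zero_mul, zero_mul]
        congr 1
        rw [evalFun_of_trans _ (T.deterministic_scheduled c) g (hω' D) ⟨hτ, rfl⟩,
          tsum_schedule_mul, T.select_of_trans (hc k s hs D hD)]
      · simp only [evalFun_of_not_enabled _ g (hω' _)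
          (mt (T.enabled_scheduled_iff c (s, k, _) none).1 hτ), hgo k s hτ]
        simp [hω]
  · intro k
    simp

end PLTS

theorem mainTheorem8 {S : Type u} {Ω : Type v} (T : PLTS S Ω) (hT : T.OmegaRespecting)
    (Δ : SubDist S) :
    (∀ Δ' : SubDist S, T.ExtremeDerivative Δ Δ' →
      ∃ (R : Type u) (TR : PLTS R Ω) (Λ : SubDist R),
        T.IsResolution Δ TR Λ ∧ Λ.expect TR.value = T.outcome Δ') ∧
    (∀ (R : Type w) (TR : PLTS R Ω) (Λ : SubDist R), T.IsResolution Δ TR Λ →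
      ∃ Δ' : SubDist S, T.ExtremeDerivative Δ Δ' ∧ Λ.expect TR.value = T.outcome Δ') :=
  ⟨fun Δ' h => T.exists_resolution hT Δ Δ' h,
    fun _ TR Λ h => T.exists_extremeDerivative hT Δ TR Λ h⟩
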